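/- Let $X(\cdot)$ be a real wide-sense stationary process with power spectral density $S_X\ge 0$, $S_X\in L^1(\mathbb R)$, i.e. $\mathbb E[X(t+\tau)X(t)]=\int_{\mathbb R} S_X(f)e^{2\pi i f\tau}\,df$ for all $t,\tau$, and put $\sigma_X^2=\int_{\mathbb R} S_X(f)\,df$. Assume that $S_X$ is unimodal, i.e. symmetric and non-increasing on $(0,\infty)$. Let $f_s,q,c_0>0$ and $R=qf_s$. Let $Z(\cdot)$ be the output of the ideal low-pass filter $H(f)=\mathbf 1_{\{|f|\le f_s/2\}}$ with input $X(\cdot)$, let $Y[n]=Z(n/f_s)$, and let $\hat Y[n]=Y[n]+\eta[n]$, $n\in\mathbb Z$, where the quantization noise $\eta[\cdot]$ is white (zero mean, pairwise uncorrelated) with variance $c_0/(2^q-1)^2$ and uncorrelated with $X(\cdot)$, i.e. $\operatorname{Cov}(\eta[n],X(t))=0$ for all $n,t$. Let $\tilde D(f_s,R)$ be the linear MMSE in estimating $X(\cdot)$ from $\hat Y[\cdot]$, that is, the minimum of $$\lim_{T\to\infty}\frac1{2T}\int_{-T}^{T}\mathbb E\big(X(t)-\hat X(t)\big)^2\,dt$$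 over all reconstructions $\hat X(t)=\sum_{n\in\mathbb Z}w(t,n)\hat Y[n]=\lim_{N\to\infty}\sum_{|n|\le N}w(t,n)\hat Y[n]$ (limit in mean square) with $w(t,\cdot)$ square summable for every $t$, for which the limit over $T$ exists. Then the minimum is attained and $$\tilde D(f_s,R)=\underline{\mathsf{mmse}}(f_s)+\int_{-f_s/2}^{f_s/2}\frac{S_X(f)}{1+\mathsf{snr}(f)}\,df,\qquad \mathsf{snr}(f)=f_s\big(2^{R/f_s}-1\big)^2\frac{S_X(f)}{c_0},$$ where $\underline{\mathsf{mmse}}(f_s)=\sigma_X^2-\max_{F}\int_F S_X(f)\,df$, the maximum being over measurable $F\subset\mathbb R$ of Lebesgue measure at most $f_s$. -/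

import Mathlib

open MeasureTheory ProbabilityTheory Filter Topology Set
open scoped ENNReal

noncomputable section

/-- `X` is a real (wide-sense) stationary process with power spectral density `S`:
`E[X(t+τ) X(t)] = ∫ S(f) e^{2πi f τ} df`, where `S ≥ 0` is integrable.  In particular the variance
`σ_X²` of the process is `∫ S(f) df`. -/
structure IsStationaryWithPSD {Ω : Type*} [MeasurableSpace Ω] (P : Measure Ω)
    (X : ℝ → Ω → ℝ) (S : ℝ → ℝ) : Prop where
  memLp : ∀ t, MemLp (X t) 2 P
  psd_nonneg : ∀ f, 0 ≤ S f
  psd_integrable : Integrable S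
  autocorrelation : ∀ t τ : ℝ,
    ((∫ ω, X (t + τ) ω * X t ω ∂P : ℝ) : ℂ) =
      ∫ f : ℝ, (S f : ℂ) * Complex.exp (2 * Real.pi * Complex.I * f * τ)

/-- A unimodal PSD: symmetric, and non-increasing for `f > 0`. -/
def IsUnimodal (S : ℝ → ℝ) : Prop :=
  (∀ f, S (-f) = S f) ∧ AntitoneOn S (Ioi 0)

/-- `η` is white noise with variance `v`: centred, with variance `v`, pairwise uncorrelated. -/
structure IsWhiteNoise {Ω : Type*} [MeasurableSpace Ω] (P : Measure Ω)
    (η : ℤ → Ω → ℝ) (v : ℝ) : Prop where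
  memLp : ∀ n, MemLp (η n) 2 P
  mean_zero : ∀ n, ∫ ω, η n ω ∂P = 0
  variance_eq : ∀ n, variance (η n) P = v
  uncorrelated : ∀ m n, m ≠ n → covariance (η m) (η n) P = 0

/-- `Z` is the output of the linear time-invariant filter with transfer function `H` whose input is
the stationary process `X` with PSD `S`.  The filter is the mean-square continuous linear extension
of `e^{2πi f u} ↦ X(u)`: `Z(t)` is the mean-square limit of finite combinations `∑ a_u X(u)` for
which the trigonometric sums `∑ a_u e^{2πi f u}` tend to `H(f) e^{2πi f t}` in `L²(S(f) df)`.
The coefficients are real because the process is real, so that `H(-f)` is the conjugate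
of `H(f)`. -/
def IsFilterOutput {Ω : Type*} [MeasurableSpace Ω] (P : Measure Ω) (X : ℝ → Ω → ℝ) (S : ℝ → ℝ)
    (H : ℝ → ℂ) (Z : ℝ → Ω → ℝ) : Prop :=
  ∀ t : ℝ, MemLp (Z t) 2 P ∧ ∀ ε : ℝ≥0∞, 0 < ε → ∃ a : ℝ →₀ ℝ,
    eLpNorm (fun f : ℝ => H f * Complex.exp (2 * Real.pi * Complex.I * f * t)
        - a.sum fun u c => (c : ℂ) * Complex.exp (2 * Real.pi * Complex.I * f * u)) 2
      (volume.withDensity fun f => ENNReal.ofReal (S f)) < ε ∧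
    eLpNorm (fun ω => Z t ω - a.sum fun u c => c * X u ω) 2 P < ε

/-- Transfer function of the ideal low-pass filter with cut-off frequency `fs / 2`. -/
def idealLowPass (fs : ℝ) (f : ℝ) : ℂ :=
  open Classical in if |f| ≤ fs / 2 then 1 else 0

/-- The quantized samples `Ŷ[n] = Y[n] + η[n]`, where `Y[n] = Z(n / fs)`. -/
def quantizedSamples {Ω : Type*} (Z : ℝ → Ω → ℝ) (fs : ℝ) (η : ℤ → Ω → ℝ) (n : ℤ) (ω : Ω) : ℝ :=
  Z (n / fs) ω + η n ω

/-- `Xhat(t) = ∑ₙ w(t,n) V[n]` for all `t`, with `w(t,·)` square summable; the two-sided series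
converges in mean square. -/
def IsLinearReconstruction {Ω : Type*} [MeasurableSpace Ω] (P : Measure Ω)
    (V : ℤ → Ω → ℝ) (Xhat : ℝ → Ω → ℝ) : Prop :=
  ∃ w : ℝ → ℤ → ℝ, ∀ t : ℝ,
    Summable (fun n : ℤ => w t n ^ 2) ∧ MemLp (Xhat t) 2 P ∧
    Tendsto (fun N : ℕ => eLpNorm
      (fun ω => Xhat t ω - ∑ n ∈ Finset.Icc (-(N : ℤ)) (N : ℤ), w t n * V n ω) 2 P)
      atTop (𝓝 0)

/-- `(1 / 2T) ∫_{-T}^{T} E (X(t) - Xhat(t))² dt`. -/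
def timeAverageMSE {Ω : Type*} [MeasurableSpace Ω] (P : Measure Ω)
    (X Xhat : ℝ → Ω → ℝ) (T : ℝ) : ℝ≥0∞ :=
  (ENNReal.ofReal (2 * T))⁻¹ *
    ∫⁻ t in Icc (-T) T, ∫⁻ ω, ENNReal.ofReal ((X t ω - Xhat t ω) ^ 2) ∂P

/-- The set of distortions `lim_{T → ∞} (1 / 2T) ∫_{-T}^{T} E (X(t) - Xhat(t))² dt` of linear
reconstructions `Xhat` of `X` from `V`. -/
def linearDistortions {Ω : Type*} [MeasurableSpace Ω] (P : Measure Ω)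
    (X : ℝ → Ω → ℝ) (V : ℤ → Ω → ℝ) : Set ℝ :=
  {D | 0 ≤ D ∧ ∃ Xhat : ℝ → Ω → ℝ, IsLinearReconstruction P V Xhat ∧
    Tendsto (timeAverageMSE P X Xhat) atTop (𝓝 (ENNReal.ofReal D))}

/-- The linear MMSE in estimating `X(·)` from `V[·]`. -/
def linearMMSE {Ω : Type*} [MeasurableSpace Ω] (P : Measure Ω)
    (X : ℝ → Ω → ℝ) (V : ℤ → Ω → ℝ) : ℝ :=
  sInf (linearDistortions P X V)

/-- `σ_X²` minus the maximal value of `∫_F S(f) df` over measurable sets `F` of Lebesgue measure at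
most `fs`. -/
def mmseLowerBound (S : ℝ → ℝ) (fs : ℝ) : ℝ :=
  (∫ f, S f) -
    sSup {e : ℝ | ∃ F : Set ℝ, MeasurableSet F ∧ volume F ≤ ENNReal.ofReal fs ∧ e = ∫ f in F, S f}

/-- `snr(f) = fs (2^{R/fs} - 1)² S(f) / c₀`. -/
def pcmSNR (S : ℝ → ℝ) (c₀ fs R f : ℝ) : ℝ :=
  fs * ((2 : ℝ) ^ (R / fs) - 1) ^ 2 * (S f / c₀)

end

/-!
The proof is Wiener filtering in Hilbert space.  By the definition of the power spectral density,
`X(t) ↦ e^{2πi f t}` is an isometry into `L²(S(f) df)`, and the filter output `Z(t)` corresponds to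
the exponential cut off to the band `B = (-fs/2, fs/2]`.  Put `v = c₀ / (2^q - 1)²` and
`c = v / fs`.  The exponentials `e^{2πi f n / fs}` are orthogonal on `B` with squared norm `fs`, so
white noise of variance `v` contributes the constant density `c`: the noisy samples have the Gram
matrix of the vectors `e^{2πi f n / fs}` in `L²(B, (S + c) df)`.  In this space `X(t)` is represented
by `G_t = g e^{2πi f t}`, where `g = S / (S + c)` is the Wiener gain.  The error of a linear
reconstruction with transfer function `W` is therefore
`∫ S - ∫_B S g + ∫_B (S + c) |W - G_t|²` at every time `t` (`norm_sub_sq_of_mem_jointSpan`), and its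
first two terms bound every time average from below (`isLeast_linearDistortions`).

For the bound to be attained, the Fourier series of `G_t` has to converge to `G_t` in
`L²(B, (S + c) df)`.  This is not automatic, because `S` may be unbounded near the origin.  But `g`
inherits unimodality from `S`, so the coefficients of `G_t` are `O(1/n)`
(`norm_integral_antitoneOn_mul_wave_le`).  Together with the positivity of the Fejér kernel this
bounds the partial sums uniformly (`IsUnimodalGain.norm_fourierPartialSum_le`), and convergence in
`L²(B, df)` passes to the weighted space by dominated convergence along subsequences
(`tendsto_eLpNorm_of_bounded_of_absolutelyContinuous`).

Finally, unimodality makes the centred interval optimal among the sets of measure at most `fs`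
(`mmseLowerBound_eq`), and `S - S g = S / (1 + S / c)` with `S / c` the signal-to-noise ratio.
-/

/-! ### Complex exponentials and the Fejér kernel -/

/-- The complex exponential `f ↦ e^{2πi f u}`. -/
noncomputable def wave (u f : ℝ) : ℂ := Complex.exp (2 * Real.pi * Complex.I * f * u)

lemma wave_add (u v f : ℝ) : wave (u + v) f = wave u f * wave v f := by
  simp only [wave, ← Complex.exp_add]; push_cast; ring_nf

lemma wave_apply_add (u f g : ℝ) : wave u (f + g) = wave u f * wave u g := by
  simp only [wave, ← Complex.exp_add]; push_cast; ring_nf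

@[simp] lemma wave_zero (f : ℝ) : wave 0 f = 1 := by simp [wave]

lemma wave_neg (u f : ℝ) : wave (-u) f = wave u (-f) := by
  simp [wave]

lemma wave_eq_cos_add_sin (u f : ℝ) :
    wave u f = (Real.cos (2 * Real.pi * f * u) : ℂ) +
      (Real.sin (2 * Real.pi * f * u) : ℂ) * Complex.I := by
  rw [wave, Complex.ofReal_cos, Complex.ofReal_sin, ← Complex.exp_mul_I]
  congr 1; push_cast; ring

lemma wave_re (u f : ℝ) : (wave u f).re = Real.cos (2 * Real.pi * f * u) := by
  rw [wave_eq_cos_add_sin]; simp [-Complex.ofReal_cos, -Complex.ofReal_sin]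

lemma wave_im (u f : ℝ) : (wave u f).im = Real.sin (2 * Real.pi * f * u) := by
  rw [wave_eq_cos_add_sin]; simp [-Complex.ofReal_cos, -Complex.ofReal_sin]

@[simp] lemma norm_wave (u f : ℝ) : ‖wave u f‖ = 1 := by
  have : wave u f = Complex.exp ((2 * Real.pi * f * u : ℝ) * Complex.I) := by
    rw [wave]; congr 1; push_cast; ring
  rw [this, Complex.norm_exp_ofReal_mul_I]

lemma conj_wave (u f : ℝ) : (starRingEnd ℂ) (wave u f) = wave (-u) f := by
  apply Complex.ext
  · simp [wave_re]
  · simp [wave_im]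

@[fun_prop] lemma continuous_wave (u : ℝ) : Continuous (wave u) := by
  unfold wave; fun_prop

lemma fourier_coe_eq_wave (T : ℝ) (n : ℤ) (x : ℝ) :
    fourier n (x : AddCircle T) = wave (n / T) x := by
  rw [fourier_coe_apply, wave]; congr 1; push_cast; ring

lemma sum_Icc_neg_succ {M : Type*} [AddCommMonoid M] (h : ℤ → M) (N : ℕ) :
    ∑ n ∈ Finset.Icc (-((N + 1 : ℕ) : ℤ)) ((N + 1 : ℕ) : ℤ), h n =
      ∑ n ∈ Finset.Icc (-(N : ℤ)) (N : ℤ), h n + (h (-((N : ℤ) + 1)) + h ((N : ℤ) + 1)) := by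
  push_cast
  rw [Finset.Icc_succ_succ N N, Finset.sum_union, Finset.sum_pair]
  · omega
  · rw [Finset.disjoint_left]
    intro a
    simp only [Finset.mem_Icc, Finset.mem_insert, Finset.mem_singleton]
    omega

/-- Sums of Dirichlet kernels are squares: this is the positivity of the Fejér kernel. -/
lemma sum_dirichlet_eq_mul {z : ℂ} (hz : z ≠ 0) (N : ℕ) :
    ∑ M ∈ Finset.range (N + 1), ∑ n ∈ Finset.Icc (-(M : ℤ)) (M : ℤ), z ^ n =
      (∑ k ∈ Finset.range (N + 1), z ^ k) * ∑ k ∈ Finset.range (N + 1), z⁻¹ ^ k := by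
  have key : ∀ (w : ℂ), w ≠ 0 → ∀ N : ℕ,
      (∑ k ∈ Finset.range (N + 1), w ^ k) * w⁻¹ ^ (N + 1)
        = ∑ k ∈ Finset.range (N + 1), w⁻¹ ^ (k + 1) := by
    intro w hw N
    rw [Finset.sum_mul, ← Finset.sum_range_reflect]
    refine Finset.sum_congr rfl fun k hk => ?_
    have hk' : k ≤ N := by simpa [Nat.lt_succ_iff] using hk
    have : N + 1 = (N - k) + (k + 1) := by omega
    rw [show N + 1 - 1 - k = N - k by omega]
    rw [this, pow_add, ← mul_assoc, ← mul_pow, mul_inv_cancel₀ hw, one_pow, one_mul]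
  have dir : ∀ N : ℕ, ∑ n ∈ Finset.Icc (-(N : ℤ)) (N : ℤ), z ^ n =
      1 + ∑ k ∈ Finset.range N, z⁻¹ ^ (k + 1) + ∑ k ∈ Finset.range N, z ^ (k + 1) := by
    intro N
    induction N with
    | zero => simp
    | succ N ih =>
      rw [sum_Icc_neg_succ, ih, Finset.sum_range_succ, Finset.sum_range_succ]
      have h1 : z ^ (-((N : ℤ) + 1)) = z⁻¹ ^ (N + 1) := by
        rw [zpow_neg, inv_pow]; norm_cast
      have h2 : z ^ ((N : ℤ) + 1) = z ^ (N + 1) := by norm_cast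
      rw [h1, h2]; ring
  induction N with
  | zero => simp
  | succ N ih =>
    rw [Finset.sum_range_succ, ih, dir, Finset.sum_range_succ _ (N + 1),
      Finset.sum_range_succ _ (N + 1)]
    have h1 := key z hz N
    have h2 := key z⁻¹ (inv_ne_zero hz) N
    rw [inv_inv] at h2
    rw [← h1, ← h2]
    have h3 : z ^ (N + 1) * z⁻¹ ^ (N + 1) = 1 := by
      rw [← mul_pow, mul_inv_cancel₀ hz, one_pow]
    linear_combination (-1 : ℂ) * h3

/-! ### Boundedness of Fourier partial sums -/

/-- The Fourier coefficients of `G` on the period `(-T/2, T/2]`. -/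
noncomputable def fourierCoeffBand (T : ℝ) (G : ℝ → ℂ) (n : ℤ) : ℂ :=
  (T : ℂ)⁻¹ * ∫ x in Ioc (-(T / 2)) (T / 2), wave (-(n / T)) x * G x

/-- The symmetric partial sums of the Fourier series of `G` on `(-T/2, T/2]`. -/
noncomputable def fourierPartialSum (T : ℝ) (G : ℝ → ℂ) (N : ℕ) (x : ℝ) : ℂ :=
  ∑ n ∈ Finset.Icc (-(N : ℤ)) (N : ℤ), fourierCoeffBand T G n * wave (n / T) x

lemma continuous_fourierPartialSum (T : ℝ) (G : ℝ → ℂ) (N : ℕ) :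
    Continuous (fourierPartialSum T G N) := by
  unfold fourierPartialSum; fun_prop

lemma integral_wave_band {T : ℝ} (hT : 0 < T) (n : ℤ) :
    ∫ x in Ioc (-(T / 2)) (T / 2), wave (n / T) x = if n = 0 then (T : ℂ) else 0 := by
  rw [← intervalIntegral.integral_of_le (by linarith)]
  split_ifs with h
  · subst h; simp
  · have hc : (2 * Real.pi * Complex.I * (n / T) : ℂ) ≠ 0 := by
      have : (n : ℂ) ≠ 0 := by exact_mod_cast h
      have : (T : ℂ) ≠ 0 := by exact_mod_cast hT.ne'
      simp [*, Complex.I_ne_zero, Real.pi_ne_zero]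
    have : ∀ x : ℝ, wave (n / T) x = Complex.exp (2 * Real.pi * Complex.I * (n / T) * x) := by
      intro x; rw [wave]; congr 1; push_cast; ring
    simp_rw [this]
    rw [integral_exp_mul_complex hc]
    have : Complex.exp (2 * Real.pi * Complex.I * (n / T) * (T / 2 : ℝ)) =
        Complex.exp (2 * Real.pi * Complex.I * (n / T) * (-(T / 2) : ℝ)) := by
      rw [Complex.exp_eq_exp_iff_exists_int]
      refine ⟨n, ?_⟩
      have : (T : ℂ) ≠ 0 := by exact_mod_cast hT.ne'
      push_cast; field_simp; ring
    rw [this, sub_self, zero_div]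

lemma integrable_wave_mul {T : ℝ} {G : ℝ → ℂ}
    (hG : IntegrableOn G (Ioc (-(T / 2)) (T / 2))) (u : ℝ) :
    IntegrableOn (fun x => wave u x * G x) (Ioc (-(T / 2)) (T / 2)) := by
  refine hG.bdd_mul (c := 1) (continuous_wave u).aestronglyMeasurable ?_
  exact ae_of_all _ fun x => (norm_wave u x).le

/-- The Cesàro sums of the Fourier series of a function bounded by `1` are bounded by `1`. -/
lemma norm_sum_fourierPartialSum_le {T : ℝ} (hT : 0 < T) {G : ℝ → ℂ}
    (hGm : AEStronglyMeasurable G (volume.restrict (Ioc (-(T / 2)) (T / 2))))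
    (hG : ∀ x, ‖G x‖ ≤ 1) (N : ℕ) (x : ℝ) :
    ‖∑ M ∈ Finset.range (N + 1), fourierPartialSum T G M x‖ ≤ N + 1 := by
  have hGi : IntegrableOn G (Ioc (-(T / 2)) (T / 2)) :=
    Integrable.of_bound hGm 1 (ae_of_all _ hG)
  -- `D` is the unnormalised Fejér kernel
  set D : ℝ → ℂ := fun u => ∑ M ∈ Finset.range (N + 1),
    ∑ n ∈ Finset.Icc (-(M : ℤ)) (M : ℤ), wave (n / T) u with hD
  have hpow : ∀ (u : ℝ) (n : ℤ), wave (n / T) u = wave (1 / T) u ^ n := by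
    intro u n
    rw [wave, wave, ← Complex.exp_int_mul]; congr 1; push_cast; ring
  have hz : ∀ u, wave (1 / T) u ≠ 0 := fun u => by
    rw [← norm_pos_iff]; simp
  have hDsq : ∀ u, D u = ((‖∑ k ∈ Finset.range (N + 1), wave (1 / T) u ^ k‖ ^ 2 : ℝ) : ℂ) := by
    intro u
    simp only [hD, hpow]
    rw [sum_dirichlet_eq_mul (hz u)]
    have : (wave (1 / T) u)⁻¹ = (starRingEnd ℂ) (wave (1 / T) u) := by
      rw [Complex.inv_def, Complex.normSq_eq_norm_sq]; simp
    rw [this]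
    simp only [← map_pow, ← map_sum]
    rw [Complex.mul_conj, Complex.normSq_eq_norm_sq]
  have hDc : Continuous D := by simp only [hD]; fun_prop
  have hDn : ∀ u, (‖D u‖ : ℂ) = D u := by
    intro u
    rw [hDsq, Complex.norm_real, Real.norm_of_nonneg (by positivity)]
  have hconv : ∑ M ∈ Finset.range (N + 1), fourierPartialSum T G M x =
      (T : ℂ)⁻¹ * ∫ y in Ioc (-(T / 2)) (T / 2), D (x - y) * G y := by
    have hexp : ∀ y, D (x - y) * G y = ∑ M ∈ Finset.range (N + 1),
        ∑ n ∈ Finset.Icc (-(M : ℤ)) (M : ℤ),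
          wave (n / T) x * (wave (-(n / T)) y * G y) := by
      intro y
      simp only [hD, Finset.sum_mul]
      refine Finset.sum_congr rfl fun M _ => Finset.sum_congr rfl fun n _ => ?_
      rw [sub_eq_add_neg, wave_apply_add, ← wave_neg]; ring
    simp_rw [hexp]
    rw [integral_finsetSum, Finset.mul_sum]
    · refine Finset.sum_congr rfl fun M _ => ?_
      rw [integral_finsetSum, Finset.mul_sum, fourierPartialSum]
      · refine Finset.sum_congr rfl fun n _ => ?_
        rw [integral_const_mul, fourierCoeffBand]; ring
      · exact fun n _ => (integrable_wave_mul hGi _).const_mul _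
    · exact fun M _ => integrable_finsetSum _ fun n _ => (integrable_wave_mul hGi _).const_mul _
  have hmass : ∫ y in Ioc (-(T / 2)) (T / 2), D (x - y) = T * (N + 1) := by
    have hexp : ∀ y, D (x - y) = ∑ M ∈ Finset.range (N + 1),
        ∑ n ∈ Finset.Icc (-(M : ℤ)) (M : ℤ), wave (n / T) x * wave (((-n : ℤ) : ℝ) / T) y := by
      intro y
      simp only [hD]
      refine Finset.sum_congr rfl fun M _ => Finset.sum_congr rfl fun n _ => ?_
      rw [sub_eq_add_neg, wave_apply_add, ← wave_neg]; push_cast; rw [neg_div]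
    have hi : ∀ n : ℤ, IntegrableOn (fun y => wave (n / T) x * wave (((-n : ℤ) : ℝ) / T) y)
        (Ioc (-(T / 2)) (T / 2)) := fun n =>
      Continuous.integrableOn_Ioc (by fun_prop)
    simp_rw [hexp]
    rw [integral_finsetSum _ fun M _ => integrable_finsetSum _ fun n _ => hi n]
    have : ∀ M ∈ Finset.range (N + 1), ∫ y in Ioc (-(T / 2)) (T / 2),
        ∑ n ∈ Finset.Icc (-(M : ℤ)) (M : ℤ), wave (n / T) x * wave (((-n : ℤ) : ℝ) / T) y
        = (T : ℂ) := by
      intro M _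
      rw [integral_finsetSum _ fun n _ => hi n]
      simp_rw [integral_const_mul, integral_wave_band hT]
      rw [Finset.sum_eq_single 0]
      · simp
      · intro n _ hn; simp [hn]
      · simp
    rw [Finset.sum_congr rfl this]
    simp; ring
  have hmass' : ∫ y in Ioc (-(T / 2)) (T / 2), ‖D (x - y)‖ = T * (N + 1) := by
    have : (((∫ y in Ioc (-(T / 2)) (T / 2), ‖D (x - y)‖ : ℝ)) : ℂ) = ((T * (N + 1) : ℝ) : ℂ) := by
      rw [← integral_complex_ofReal]
      simp_rw [hDn]
      rw [hmass]; push_cast; rfl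
    exact_mod_cast this
  rw [hconv, norm_mul, norm_inv, Complex.norm_real, Real.norm_of_nonneg hT.le]
  have : ‖∫ y in Ioc (-(T / 2)) (T / 2), D (x - y) * G y‖ ≤ T * (N + 1) := by
    rw [← hmass']
    refine norm_integral_le_of_norm_le ?_ (ae_of_all _ fun y => ?_)
    · exact Continuous.integrableOn_Ioc (by fun_prop)
    · rw [norm_mul]; exact mul_le_of_le_one_right (norm_nonneg _) (hG y)
  calc T⁻¹ * _ ≤ T⁻¹ * (T * (N + 1)) := by gcongr
    _ = N + 1 := by field_simp

/-- A sequence whose increments are `O(1/n)` stays within bounded distance of its Cesàro means. -/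
lemma norm_le_of_cesaro_le {s : ℕ → ℂ} {A C : ℝ}
    (hA : ∀ N : ℕ, ‖∑ M ∈ Finset.range (N + 1), s M‖ ≤ A * (N + 1))
    (hC : ∀ N : ℕ, (N + 1) * ‖s (N + 1) - s N‖ ≤ C) (N : ℕ) : ‖s N‖ ≤ A + C := by
  have hC0 : 0 ≤ C := le_trans (by positivity) (hC 0)
  -- the difference is `∑ M * (s M - s (M - 1))`, by summation by parts
  have h : ∀ N : ℕ, ‖(N + 1) * s N - ∑ M ∈ Finset.range (N + 1), s M‖ ≤ C * N := by
    intro N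
    induction N with
    | zero => simp
    | succ N ih =>
      have : ((N + 1 : ℕ) + 1) * s (N + 1) - ∑ M ∈ Finset.range (N + 1 + 1), s M =
          ((N + 1) * s N - ∑ M ∈ Finset.range (N + 1), s M) + (N + 1) * (s (N + 1) - s N) := by
        rw [Finset.sum_range_succ _ (N + 1)]; push_cast; ring
      rw [this]
      refine (norm_add_le _ _).trans ?_
      have h2 : ‖((N : ℂ) + 1) * (s (N + 1) - s N)‖ ≤ C := by
        rw [norm_mul]
        have : ‖(N : ℂ) + 1‖ = N + 1 := by
          exact_mod_cast Complex.norm_natCast (N + 1)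
        rw [this]; exact hC N
      push_cast; linarith
  have h1 : (N + 1) * ‖s N‖ ≤ (A + C) * (N + 1) := by
    have e : (N + 1) * ‖s N‖ = ‖((N : ℂ) + 1) * s N‖ := by
      rw [norm_mul]; congr 1; exact_mod_cast (Complex.norm_natCast (N + 1)).symm
    rw [e]
    calc _ = ‖((N + 1) * s N - ∑ M ∈ Finset.range (N + 1), s M)
          + ∑ M ∈ Finset.range (N + 1), s M‖ := by rw [sub_add_cancel]
      _ ≤ C * N + A * (N + 1) := (norm_add_le _ _).trans (add_le_add (h N) (hA N))
      _ ≤ _ := by nlinarith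
  have : (0 : ℝ) < N + 1 := by positivity
  nlinarith

/-! ### Decay of the Fourier coefficients of monotone functions -/

/-- If `g` takes values in `[0,1]` and is non-increasing on `(0, ∞)`, its Fourier integral over
`(0, b]` decays like the inverse frequency.  Translation by the half period `h = 1 / (2|u|)` changes
the sign of the wave, so twice the integral is bounded by the integral of `|g(x) - g(x + h)|`, which
telescopes because `g` is monotone. -/
lemma norm_integral_antitoneOn_mul_wave_le {g : ℝ → ℝ} (hga : AntitoneOn g (Ioi 0))
    (h0 : ∀ x, 0 ≤ g x) (h1 : ∀ x, g x ≤ 1) (hgm : AEStronglyMeasurable g) (b : ℝ) {u : ℝ}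
    (hu : u ≠ 0) :
    ‖∫ x in Ioc 0 b, (g x : ℂ) * wave u x‖ ≤ 1 / (2 * |u|) := by
  have hu' : 0 < |u| := abs_pos.mpr hu
  set h : ℝ := 1 / (2 * |u|) with hh
  have hpos : 0 < h := by positivity
  have hwave : wave u h = -1 := by
    have hc : Real.cos (2 * Real.pi * h * u) = -1 ∧ Real.sin (2 * Real.pi * h * u) = 0 := by
      rcases abs_choice u with e | e
      · have : 2 * Real.pi * h * u = Real.pi := by
          rw [hh, e]; field_simp
        rw [this]; simp
      · have : 2 * Real.pi * h * u = -Real.pi := by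
          rw [hh, e]; field_simp
        rw [this]; simp
    rw [wave_eq_cos_add_sin, hc.1, hc.2]; simp
  -- extending by zero keeps monotonicity and lets translation act on the whole line
  set k : ℝ → ℝ := (Ioc 0 b).indicator g with hk
  have hk0 : ∀ x, 0 ≤ k x := fun x => indicator_nonneg (fun y _ => h0 y) x
  have hk1 : ∀ x, k x ≤ 1 := fun x => indicator_apply_le' (fun _ => h1 x) (fun _ => zero_le_one)
  have hki : Integrable k := by
    rw [hk, integrable_indicator_iff measurableSet_Ioc]
    refine Integrable.of_bound hgm.restrict 1 (ae_of_all _ fun x => ?_)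
    rw [Real.norm_of_nonneg (h0 x)]; exact h1 x
  have hkanti : ∀ x, 0 < x → k (x + h) ≤ k x := by
    intro x hx
    simp only [hk, indicator_apply, mem_Ioc]
    by_cases hb : x + h ≤ b
    · rw [if_pos ⟨by linarith, hb⟩, if_pos ⟨hx, by linarith⟩]
      exact hga hx (by simp only [mem_Ioi]; linarith) (by linarith)
    · rw [if_neg (by tauto)]
      split_ifs
      exacts [h0 x, le_rfl]
  have hkw : Integrable (fun x => (k x : ℂ) * wave u x) := by
    refine hki.ofReal.mul_bdd (c := 1) (continuous_wave u).aestronglyMeasurable ?_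
    exact ae_of_all _ fun x => (norm_wave u x).le
  have hI : ∫ x in Ioc 0 b, (g x : ℂ) * wave u x = ∫ x, (k x : ℂ) * wave u x := by
    rw [← integral_indicator measurableSet_Ioc]
    congr 1; ext x
    simp only [hk, indicator_apply]
    split_ifs <;> simp
  have hshift : ∀ x, (k (x + h) : ℂ) * wave u x = -((k (x + h) : ℂ) * wave u (x + h)) := by
    intro x; rw [wave_apply_add, hwave]; ring
  have hkw' : Integrable (fun x => (k (x + h) : ℂ) * wave u x) := by
    simp_rw [hshift]; exact (hkw.comp_add_right h).neg
  have hJ : ∫ x, (k (x + h) : ℂ) * wave u x = - ∫ x, (k x : ℂ) * wave u x := by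
    simp_rw [hshift]
    rw [integral_neg, integral_add_right_eq_self (fun x => (k x : ℂ) * wave u x)]
  have h2 : 2 * ∫ x, (k x : ℂ) * wave u x = ∫ x, ((k x : ℂ) - k (x + h)) * wave u x := by
    simp_rw [sub_mul]
    rw [integral_sub hkw hkw', hJ]; ring
  have hind : Integrable ((Ioc (-h) 0).indicator fun _ : ℝ => (2 : ℝ)) :=
    (integrable_indicator_iff measurableSet_Ioc).mpr (integrableOn_const (by simp))
  have hbound : ‖∫ x, ((k x : ℂ) - k (x + h)) * wave u x‖ ≤
      ∫ x, ((k x - k (x + h)) + (Ioc (-h) 0).indicator (fun _ => (2 : ℝ)) x) := by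
    refine norm_integral_le_of_norm_le ((hki.sub (hki.comp_add_right h)).add hind)
      (ae_of_all _ fun x => ?_)
    rw [norm_mul, norm_wave, mul_one, ← Complex.ofReal_sub, Complex.norm_real, Real.norm_eq_abs]
    rcases lt_or_ge 0 x with hx | hx
    · rw [abs_of_nonneg (by linarith [hkanti x hx]), indicator_of_notMem (by simp [hx])]
      simp
    · have hkx : k x = 0 := indicator_of_notMem (by simp [hx]) _
      rcases lt_or_ge (-h) x with hx' | hx'
      · rw [indicator_of_mem (show x ∈ Ioc (-h) 0 from ⟨hx', hx⟩), hkx, zero_sub, abs_neg,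
          abs_of_nonneg (hk0 _)]
        linarith [hk1 (x + h)]
      · have hkx' : k (x + h) = 0 :=
          indicator_of_notMem (by simp only [mem_Ioc, not_and_or, not_lt]; left; linarith) _
        rw [hkx, hkx', indicator_of_notMem (by simp [hx'])]; simp
  have hval : ∫ x, ((k x - k (x + h)) + (Ioc (-h) 0).indicator (fun _ => (2 : ℝ)) x) = 2 * h := by
    have hki' : Integrable fun x => k x - k (x + h) := hki.sub (hki.comp_add_right h)
    rw [integral_add hki' hind,
      integral_sub hki (hki.comp_add_right h), integral_add_right_eq_self k, sub_self, zero_add,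
      integral_indicator measurableSet_Ioc]
    simp [hpos.le]; ring
  rw [hI]
  have : 2 * ‖∫ x, (k x : ℂ) * wave u x‖ ≤ 2 * h := by
    rw [← hval]
    refine le_trans (le_of_eq ?_) hbound
    rw [← h2, norm_mul]; simp
  linarith

/-- Reflection of an integral over a symmetric interval. -/
lemma integral_Ioc_neg {T : ℝ} (hT : 0 < T) (F : ℝ → ℂ) :
    ∫ x in Ioc (-(T / 2)) (T / 2), F (-x) = ∫ x in Ioc (-(T / 2)) (T / 2), F x := by
  rw [← intervalIntegral.integral_of_le (by linarith), ← intervalIntegral.integral_of_le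
    (by linarith), intervalIntegral.integral_comp_neg, neg_neg]

/-- A real function on the line that is even, non-increasing on `(0, ∞)` and takes values in
`[0,1]`. -/
structure IsUnimodalGain (g : ℝ → ℝ) : Prop where
  even : ∀ x, g (-x) = g x
  antitoneOn : AntitoneOn g (Ioi 0)
  nonneg : ∀ x, 0 ≤ g x
  le_one : ∀ x, g x ≤ 1
  aestronglyMeasurable : AEStronglyMeasurable g

namespace IsUnimodalGain

variable {g : ℝ → ℝ}

lemma norm_mul_wave_le (hg : IsUnimodalGain g) (t x : ℝ) : ‖(g x : ℂ) * wave t x‖ ≤ 1 := by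
  rw [norm_mul, norm_wave, mul_one, Complex.norm_real, Real.norm_of_nonneg (hg.nonneg x)]
  exact hg.le_one x

lemma aestronglyMeasurable_mul_wave (hg : IsUnimodalGain g) (t : ℝ) :
    AEStronglyMeasurable (fun x => (g x : ℂ) * wave t x) :=
  (Complex.continuous_ofReal.comp_aestronglyMeasurable hg.aestronglyMeasurable).mul
    (continuous_wave t).aestronglyMeasurable

lemma integrableOn_mul_wave (hg : IsUnimodalGain g) (t a b : ℝ) :
    IntegrableOn (fun x => (g x : ℂ) * wave t x) (Ioc a b) :=
  Integrable.of_bound (hg.aestronglyMeasurable_mul_wave t).restrict 1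
    (ae_of_all _ (hg.norm_mul_wave_le t))

lemma norm_integral_mul_wave_le (hg : IsUnimodalGain g) {T : ℝ} (hT : 0 < T) {u : ℝ}
    (hu : u ≠ 0) : ‖∫ x in Ioc (-(T / 2)) (T / 2), (g x : ℂ) * wave u x‖ ≤ 1 / |u| := by
  have hi : ∀ a b : ℝ, a ≤ b →
      IntervalIntegrable (fun x => (g x : ℂ) * wave u x) volume a b := fun a b hab =>
    (intervalIntegrable_iff_integrableOn_Ioc_of_le hab).mpr (hg.integrableOn_mul_wave u a b)
  rw [← intervalIntegral.integral_of_le (by linarith),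
    ← intervalIntegral.integral_add_adjacent_intervals (hi _ 0 (by linarith))
      (hi 0 _ (by linarith))]
  have hrefl : ∫ x in (-(T / 2))..0, (g x : ℂ) * wave u x =
      ∫ x in (0 : ℝ)..(T / 2), (g x : ℂ) * wave (-u) x := by
    have := intervalIntegral.integral_comp_neg (a := 0) (b := T / 2)
      (fun x => (g x : ℂ) * wave u x)
    rw [neg_zero] at this
    rw [← this]
    refine intervalIntegral.integral_congr fun x _ => ?_
    simp only [hg.even, wave_neg]
  rw [hrefl, intervalIntegral.integral_of_le (by linarith),
    intervalIntegral.integral_of_le (by linarith)]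
  have e1 := norm_integral_antitoneOn_mul_wave_le hg.antitoneOn hg.nonneg hg.le_one
    hg.aestronglyMeasurable (T / 2) hu
  have e2 := norm_integral_antitoneOn_mul_wave_le hg.antitoneOn hg.nonneg hg.le_one
    hg.aestronglyMeasurable (T / 2) (neg_ne_zero.mpr hu)
  rw [abs_neg] at e2
  calc _ ≤ _ := norm_add_le _ _
    _ ≤ 1 / (2 * |u|) + 1 / (2 * |u|) := add_le_add e2 e1
    _ = 1 / |u| := by have := abs_pos.mpr hu; field_simp; norm_num

lemma fourierCoeffBand_eq (T t : ℝ) (n : ℤ) :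
    fourierCoeffBand T (fun x => (g x : ℂ) * wave t x) n =
      (T : ℂ)⁻¹ * ∫ x in Ioc (-(T / 2)) (T / 2), (g x : ℂ) * wave (t - n / T) x := by
  rw [fourierCoeffBand]
  congr 2; ext x
  rw [sub_eq_add_neg, wave_add]; ring

/-- The coefficients are real because the gain is even. -/
lemma fourierCoeffBand_re (hg : IsUnimodalGain g) {T : ℝ} (hT : 0 < T) (t : ℝ) (n : ℤ) :
    ((fourierCoeffBand T (fun x => (g x : ℂ) * wave t x) n).re : ℂ) =
      fourierCoeffBand T (fun x => (g x : ℂ) * wave t x) n := by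
  rw [← Complex.conj_eq_iff_re, fourierCoeffBand_eq, map_mul, ← integral_conj]
  simp only [map_mul, Complex.conj_ofReal, map_inv₀]
  congr 1
  rw [← integral_Ioc_neg hT]
  congr 1; ext x
  rw [conj_wave, hg.even, ← wave_neg, neg_neg]

lemma abs_mul_norm_fourierCoeffBand_le (hg : IsUnimodalGain g) {T : ℝ} (hT : 0 < T) (t : ℝ)
    (n : ℤ) : |(n : ℝ)| * ‖fourierCoeffBand T (fun x => (g x : ℂ) * wave t x) n‖ ≤
      2 + 2 * |t * T| := by
  set c := ‖fourierCoeffBand T (fun x => (g x : ℂ) * wave t x) n‖ with hc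
  have hc0 : 0 ≤ c := norm_nonneg _
  have hceq : c = T⁻¹ * ‖∫ x in Ioc (-(T / 2)) (T / 2), (g x : ℂ) * wave (t - n / T) x‖ := by
    rw [hc, fourierCoeffBand_eq, norm_mul, norm_inv, Complex.norm_real, Real.norm_of_nonneg hT.le]
  have hc1 : c ≤ 1 := by
    have : ‖∫ x in Ioc (-(T / 2)) (T / 2), (g x : ℂ) * wave (t - n / T) x‖ ≤ T := by
      refine (norm_setIntegral_le_of_norm_le_const (C := 1) (by simp)
        fun x _ => hg.norm_mul_wave_le _ x).trans ?_
      simp [hT.le]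
    rw [hceq]
    calc T⁻¹ * _ ≤ T⁻¹ * T := by gcongr
      _ = 1 := by field_simp
  -- small `n` are covered by `c ≤ 1`; for large `n` the frequency `t - n / T` is of order `n / T`
  rcases le_or_gt |(n : ℝ)| (2 * |t * T|) with hn | hn
  · nlinarith [abs_nonneg (t * T), abs_nonneg (n : ℝ)]
  · have hlow : |(n : ℝ)| / 2 ≤ |t * T - n| := by
      have := abs_sub_abs_le_abs_sub (n : ℝ) (t * T)
      rw [abs_sub_comm] at this
      linarith
    have hnpos : 0 < |(n : ℝ)| := lt_of_le_of_lt (by positivity) hn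
    have hne : t - n / T ≠ 0 := by
      intro h0
      have : t * T - n = 0 := by
        have : t * T - n = (t - n / T) * T := by field_simp
        rw [this, h0, zero_mul]
      rw [this, abs_zero] at hlow
      linarith
    have hle := hg.norm_integral_mul_wave_le hT hne
    have hcle : c * |t * T - n| ≤ 1 := by
      have e : |t * T - n| = T * |t - n / T| := by
        rw [← abs_of_pos hT, ← abs_mul, abs_of_pos hT]; congr 1; field_simp
      have hp : 0 < |t - n / T| := abs_pos.mpr hne
      rw [e, hceq]
      calc _ ≤ T⁻¹ * (1 / |t - n / T|) * (T * |t - n / T|) := by gcongr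
        _ = 1 := by
          rw [mul_mul_mul_comm, inv_mul_cancel₀ hT.ne', one_div_mul_cancel hp.ne',
            one_mul]
    nlinarith [abs_nonneg (t * T)]

/-- The Fourier partial sums of a unimodal gain times an exponential are uniformly bounded:
the Cesàro means are bounded by positivity of the Fejér kernel, and the coefficients are
`O(1/n)`. -/
lemma norm_fourierPartialSum_le (hg : IsUnimodalGain g) {T : ℝ} (hT : 0 < T) (t : ℝ) (N : ℕ)
    (x : ℝ) : ‖fourierPartialSum T (fun x => (g x : ℂ) * wave t x) N x‖ ≤
      1 + 2 * (2 + 2 * |t * T|) := by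
  refine norm_le_of_cesaro_le (s := fun N => fourierPartialSum T _ N x) (fun N => ?_)
    (fun N => ?_) N
  · rw [one_mul]
    exact norm_sum_fourierPartialSum_le hT (hg.aestronglyMeasurable_mul_wave t).restrict
      (hg.norm_mul_wave_le t) N x
  · rw [fourierPartialSum, sum_Icc_neg_succ, ← fourierPartialSum, add_sub_cancel_left]
    have e1 := hg.abs_mul_norm_fourierCoeffBand_le hT t (-((N : ℤ) + 1))
    have e2 := hg.abs_mul_norm_fourierCoeffBand_le hT t ((N : ℤ) + 1)
    have hN : |(N : ℝ) + 1| = N + 1 := abs_of_nonneg (by positivity)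
    push_cast at e1 e2
    rw [abs_neg, hN] at e1
    rw [hN] at e2
    refine (mul_le_mul_of_nonneg_left (norm_add_le _ _) (by positivity)).trans ?_
    rw [norm_mul, norm_mul, norm_wave, norm_wave, mul_one, mul_one, mul_add, two_mul]
    exact add_le_add e1 e2

end IsUnimodalGain

/-! ### Mean-square convergence of Fourier partial sums -/

lemma fourierCoeff_liftIoc_eq_fourierCoeffBand {T : ℝ} [Fact (0 < T)] (G : ℝ → ℂ) (n : ℤ) :
    fourierCoeff (AddCircle.liftIoc T (-(T / 2)) G) n = fourierCoeffBand T G n := by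
  have hT : 0 < T := Fact.out
  have e : -(T / 2) + T = T / 2 := by ring
  rw [fourierCoeff_eq_intervalIntegral _ _ (-(T / 2)), e, fourierCoeffBand,
    intervalIntegral.integral_of_le (by linarith), Complex.real_smul]
  push_cast
  rw [one_div]
  congr 1
  refine setIntegral_congr_fun measurableSet_Ioc fun x hx => ?_
  simp only [fourier_coe_eq_wave, smul_eq_mul]
  rw [AddCircle.liftIoc_coe_apply (by rwa [e])]
  push_cast
  rw [neg_div]

lemma memLp_liftIoc_haar {T : ℝ} [Fact (0 < T)] {G : ℝ → ℂ}
    (hG : MemLp G 2 (volume.restrict (Ioc (-(T / 2)) (T / 2)))) :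
    MemLp (AddCircle.liftIoc T (-(T / 2)) G) 2 (AddCircle.haarAddCircle (T := T)) := by
  have e : -(T / 2) + T = T / 2 := by ring
  refine (MemLp.memLp_liftIoc ?_).haarAddCircle
  rwa [e]

lemma summable_sq_fourierCoeffBand {T : ℝ} (hT : 0 < T) {G : ℝ → ℂ}
    (hG : MemLp G 2 (volume.restrict (Ioc (-(T / 2)) (T / 2)))) :
    Summable fun n : ℤ => ‖fourierCoeffBand T G n‖ ^ 2 := by
  have : Fact (0 < T) := ⟨hT⟩
  have h := memLp_liftIoc_haar hG
  have hs := (hasSum_sq_fourierCoeff h.toLp).summable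
  rw [fourierCoeff_congr_ae h.coeFn_toLp] at hs
  simpa only [fourierCoeff_liftIoc_eq_fourierCoeffBand] using hs

lemma tendsto_eLpNorm_sub_fourierPartialSum {T : ℝ} (hT : 0 < T) {G : ℝ → ℂ}
    (hG : MemLp G 2 (volume.restrict (Ioc (-(T / 2)) (T / 2)))) :
    Tendsto (fun N : ℕ => eLpNorm (fourierPartialSum T G N - G) 2
      (volume.restrict (Ioc (-(T / 2)) (T / 2)))) atTop (𝓝 0) := by
  have : Fact (0 < T) := ⟨hT⟩
  have e : -(T / 2) + T = T / 2 := by ring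
  have h := memLp_liftIoc_haar hG
  have hs := hasSum_fourier_series_L2 h.toLp
  rw [fourierCoeff_congr_ae h.coeFn_toLp] at hs
  simp only [fourierCoeff_liftIoc_eq_fourierCoeffBand] at hs
  have ht := hs.comp (Finset.tendsto_Icc_neg (R := ℤ))
  rw [Lp.tendsto_Lp_iff_tendsto_eLpNorm'] at ht
  -- the approximation errors, as functions on the circle
  set F : ℕ → AddCircle T → ℂ := fun N x =>
    (∑ n ∈ Finset.Icc (-(N : ℤ)) (N : ℤ), fourierCoeffBand T G n * fourier n x) -
      AddCircle.liftIoc T (-(T / 2)) G x with hF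
  have hae : ∀ N : ℕ, (⇑(∑ n ∈ Finset.Icc (-(N : ℤ)) (N : ℤ),
      fourierCoeffBand T G n • fourierLp (T := T) 2 n) - ⇑h.toLp) =ᵐ[AddCircle.haarAddCircle]
      F N := by
    intro N
    have h1 := Lp.coeFn_finsetSum (Finset.Icc (-(N : ℤ)) (N : ℤ))
      fun n => fourierCoeffBand T G n • fourierLp (T := T) 2 n
    have h2 : ∀ᵐ x ∂(AddCircle.haarAddCircle (T := T)), ∀ n : ℤ,
        (fourierCoeffBand T G n • fourierLp (T := T) 2 n : Lp ℂ 2 _) x =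
          fourierCoeffBand T G n * fourier n x := by
      rw [ae_all_iff]; intro n
      filter_upwards [Lp.coeFn_smul (fourierCoeffBand T G n) (fourierLp (T := T) 2 n),
        coeFn_fourierLp 2 n] with x hx1 hx2
      rw [hx1, Pi.smul_apply, hx2, smul_eq_mul]
    filter_upwards [h1, h2, h.coeFn_toLp] with x hx1 hx2 hx3
    simp only [Pi.sub_apply, hx1, hx3, hF, Finset.sum_apply, hx2]
  have ht' : Tendsto (fun N => eLpNorm (F N) 2 (AddCircle.haarAddCircle (T := T))) atTop (𝓝 0) :=
    ht.congr fun N => eLpNorm_congr_ae (hae N)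
  have ht'' : Tendsto (fun N => eLpNorm (F N) 2 (volume : Measure (AddCircle T))) atTop (𝓝 0) := by
    rw [AddCircle.volume_eq_smul_haarAddCircle]
    simp_rw [eLpNorm_smul_measure_of_ne_top (p := 2) (by simp), smul_eq_mul]
    have := ENNReal.Tendsto.const_mul (a := ENNReal.ofReal T ^ (1 / (2 : ℝ≥0∞)).toReal) ht'
      (Or.inr (by finiteness))
    rwa [mul_zero] at this
  refine ht''.congr fun N => ?_
  have hm : AEStronglyMeasurable (F N) (volume : Measure (AddCircle T)) := by
    refine AEStronglyMeasurable.sub ?_ h.of_haarAddCircle.1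
    refine Continuous.aestronglyMeasurable ?_
    fun_prop
  rw [← eLpNorm_comp_measurePreserving hm (AddCircle.measurePreserving_mk T (-(T / 2))), e]
  refine eLpNorm_congr_ae ?_
  filter_upwards [ae_restrict_mem measurableSet_Ioc] with x hx
  simp only [hF, Function.comp_apply, fourier_coe_eq_wave, Pi.sub_apply, fourierPartialSum]
  rw [AddCircle.liftIoc_coe_apply (by rwa [e])]

/-- Uniformly bounded functions converging to zero in `L²(ν)` converge to zero in `L²(μ)` for every
finite measure `μ ≪ ν`. -/
lemma tendsto_eLpNorm_of_bounded_of_absolutelyContinuous {α : Type*} [MeasurableSpace α]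
    {μ ν : Measure α} [IsFiniteMeasure μ] (hμν : μ ≪ ν) {h : ℕ → α → ℂ} {K : ℝ}
    (hm : ∀ N, AEStronglyMeasurable (h N) ν) (hK : ∀ N x, ‖h N x‖ ≤ K)
    (ht : Tendsto (fun N => eLpNorm (h N) 2 ν) atTop (𝓝 0)) :
    Tendsto (fun N => eLpNorm (h N) 2 μ) atTop (𝓝 0) := by
  refine tendsto_of_subseq_tendsto fun ns hns => ?_
  have hmeas : TendstoInMeasure ν (fun i => h (ns i)) atTop 0 := by
    refine tendstoInMeasure_of_tendsto_eLpNorm (p := 2) (by simp) (fun i => hm _)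
      aestronglyMeasurable_const ?_
    simpa only [sub_zero, Function.comp_def] using ht.comp hns
  obtain ⟨ms, hms, hae⟩ := hmeas.exists_seq_tendsto_ae
  refine ⟨ms, ?_⟩
  have hae' := hμν.ae_le hae
  have key : Tendsto (fun i => ∫⁻ x, ‖h (ns (ms i)) x‖ₑ ^ (2 : ℝ) ∂μ) atTop
      (𝓝 (∫⁻ _, 0 ∂μ)) := by
    refine tendsto_lintegral_of_dominated_convergence' (fun _ => ENNReal.ofReal K ^ (2 : ℝ))
      (fun i => ((hm _).mono_ac hμν).enorm.pow_const _) (fun i => ae_of_all _ fun x => ?_) ?_ ?_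
    · refine ENNReal.rpow_le_rpow ?_ (by norm_num)
      rw [← ofReal_norm]
      exact ENNReal.ofReal_le_ofReal (hK _ x)
    · rw [lintegral_const]; finiteness
    · filter_upwards [hae'] with x hx
      have h1 : Tendsto (fun i => ‖h (ns (ms i)) x‖ₑ) atTop (𝓝 0) := by
        simpa [Function.comp_def] using (continuous_enorm.tendsto _).comp hx
      have h2 := (ENNReal.continuous_rpow_const (y := 2)).tendsto 0 |>.comp h1
      simpa [Function.comp_def] using h2
  rw [lintegral_zero] at key
  have h3 := (ENNReal.continuous_rpow_const (y := 1 / 2)).tendsto 0 |>.comp key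
  rw [ENNReal.zero_rpow_of_pos (by norm_num)] at h3
  refine h3.congr fun i => ?_
  rw [eLpNorm_eq_lintegral_rpow_enorm_toReal (by simp) (by simp)]
  simp

/-! ### Families of vectors with the same Gram matrix -/

section Gram

variable {ι E F : Type*} [NormedAddCommGroup E] [InnerProductSpace ℝ E]
  [NormedAddCommGroup F] [InnerProductSpace ℝ F]

/-- The closed span of the pairs `(x i, y i)`.  When the two families have the same Gram matrix,
this is the graph of the isometry `x i ↦ y i` between their closed spans. -/
noncomputable def jointSpan (x : ι → E) (y : ι → F) : Submodule ℝ (E × F) :=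
  (Submodule.span ℝ (range fun i => (x i, y i))).topologicalClosure

lemma sum_mem_jointSpan (x : ι → E) (y : ι → F) (s : Finset ι) (a : ι → ℝ) :
    (∑ i ∈ s, a i • x i, ∑ i ∈ s, a i • y i) ∈ jointSpan x y := by
  have : (∑ i ∈ s, a i • x i, ∑ i ∈ s, a i • y i) = ∑ i ∈ s, a i • (x i, y i) := by
    apply Prod.ext
    · simp [Prod.fst_sum]
    · simp [Prod.snd_sum]
  rw [this]
  exact Submodule.le_topologicalClosure _ <| Submodule.sum_mem _ fun i _ =>
    Submodule.smul_mem _ _ (Submodule.subset_span ⟨i, rfl⟩)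

lemma inner_eq_inner_of_mem_jointSpan {x : ι → E} {y : ι → F} {a : E} {b : F}
    (h : ∀ i, inner ℝ a (x i) = inner ℝ b (y i)) {p : E × F} (hp : p ∈ jointSpan x y) :
    inner ℝ a p.1 = inner ℝ b p.2 := by
  have hc : IsClosed {p : E × F | inner ℝ a p.1 = inner ℝ b p.2} :=
    isClosed_eq (by fun_prop) (by fun_prop)
  refine closure_minimal (fun q hq => ?_) hc hp
  refine Submodule.span_induction ?_ ?_ ?_ ?_ hq
  · rintro _ ⟨i, rfl⟩; exact h i
  · simp
  · intro u v _ _ hu hv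
    simp only [mem_ofPred_eq, Prod.fst_add, Prod.snd_add, inner_add_right] at *
    rw [hu, hv]
  · intro c u _ hu
    simp only [mem_ofPred_eq, Prod.smul_fst, Prod.smul_snd, inner_smul_right] at *
    rw [hu]

lemma inner_fst_eq_inner_snd {x : ι → E} {y : ι → F}
    (h : ∀ i j, inner ℝ (x i) (x j) = inner ℝ (y i) (y j)) {p q : E × F}
    (hp : p ∈ jointSpan x y) (hq : q ∈ jointSpan x y) :
    inner ℝ p.1 q.1 = inner ℝ p.2 q.2 := by
  refine inner_eq_inner_of_mem_jointSpan (fun i => ?_) hq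
  rw [real_inner_comm, real_inner_comm (y i)]
  exact inner_eq_inner_of_mem_jointSpan (h i) hp

/-- If `b` represents `a` against the family, the distance from `a` to a vector of the span and
the distance from `b` to its image differ by the constant `‖a‖² - ‖b‖²`. -/
lemma norm_sub_sq_of_mem_jointSpan {x : ι → E} {y : ι → F}
    (h : ∀ i j, inner ℝ (x i) (x j) = inner ℝ (y i) (y j)) {a : E} {b : F}
    (hab : ∀ i, inner ℝ a (x i) = inner ℝ b (y i)) {p : E × F} (hp : p ∈ jointSpan x y) :
    ‖a - p.1‖ ^ 2 = ‖a‖ ^ 2 - ‖b‖ ^ 2 + ‖b - p.2‖ ^ 2 := by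
  have h1 := inner_eq_inner_of_mem_jointSpan hab hp
  have h2 := inner_fst_eq_inner_snd h hp hp
  rw [real_inner_self_eq_norm_sq, real_inner_self_eq_norm_sq] at h2
  rw [norm_sub_sq_real, norm_sub_sq_real, h1, h2]
  ring

/-- Convergence of a series in one family transfers to the other one. -/
lemma exists_tendsto_of_tendsto_of_gram [CompleteSpace E] {x : ι → E} {y : ι → F}
    (h : ∀ i j, inner ℝ (x i) (x j) = inner ℝ (y i) (y j)) {s : ℕ → Finset ι} {a : ι → ℝ} {b : F}
    (hb : Tendsto (fun N => ∑ i ∈ s N, a i • y i) atTop (𝓝 b)) :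
    ∃ u : E, Tendsto (fun N => ∑ i ∈ s N, a i • x i) atTop (𝓝 u) ∧ (u, b) ∈ jointSpan x y := by
  have hdist : ∀ M N, dist (∑ i ∈ s M, a i • x i) (∑ i ∈ s N, a i • x i) =
      dist (∑ i ∈ s M, a i • y i) (∑ i ∈ s N, a i • y i) := by
    intro M N
    have hm := Submodule.sub_mem _ (sum_mem_jointSpan x y (s M) a) (sum_mem_jointSpan x y (s N) a)
    have h2 := inner_fst_eq_inner_snd h hm hm
    rw [real_inner_self_eq_norm_sq, real_inner_self_eq_norm_sq] at h2
    rw [dist_eq_norm, dist_eq_norm]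
    exact (sq_eq_sq₀ (norm_nonneg _) (norm_nonneg _)).mp h2
  have hcau : CauchySeq fun N => ∑ i ∈ s N, a i • x i := by
    have := hb.cauchySeq
    rw [Metric.cauchySeq_iff] at this ⊢
    simpa only [hdist] using this
  obtain ⟨u, hu⟩ := cauchySeq_tendsto_of_complete hcau
  refine ⟨u, hu, ?_⟩
  exact (Submodule.isClosed_topologicalClosure _).mem_of_tendsto (hu.prodMk_nhds hb)
    (Eventually.of_forall fun N => sum_mem_jointSpan x y (s N) a)

end Gram

/-! ### Processes as curves in a Hilbert space -/

section Reconstruction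

variable {Ω : Type*} [MeasurableSpace Ω] {P : Measure Ω}

lemma toLp_sum {ι α E : Type*} [MeasurableSpace α] [NormedAddCommGroup E] [NormedSpace ℝ E]
    {κ : Measure α} {f : ι → α → E} (hf : ∀ i, MemLp (f i) 2 κ) (s : Finset ι) (a : ι → ℝ)
    (hs : MemLp (fun ω => ∑ i ∈ s, a i • f i ω) 2 κ) :
    hs.toLp = ∑ i ∈ s, a i • (hf i).toLp := by
  apply Lp.ext
  have h2 : ∀ᵐ x ∂κ, ∀ i ∈ s, (a i • (hf i).toLp : Lp E 2 κ) x = a i • f i x := by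
    rw [Filter.eventually_all_finset]
    intro i _
    filter_upwards [Lp.coeFn_smul (a i) (hf i).toLp, (hf i).coeFn_toLp] with x h1 h2
    rw [h1, Pi.smul_apply, h2]
  filter_upwards [hs.coeFn_toLp, Lp.coeFn_finsetSum s fun i => a i • (hf i).toLp, h2]
    with x h1 h3 h4
  rw [h1, h3, Finset.sum_apply]
  exact Finset.sum_congr rfl fun i hi => (h4 i hi).symm

lemma memLp_sum_smul {ι α E : Type*} [MeasurableSpace α] [NormedAddCommGroup E] [NormedSpace ℝ E]
    {κ : Measure α} {f : ι → α → E} (hf : ∀ i, MemLp (f i) 2 κ) (s : Finset ι) (a : ι → ℝ) :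
    MemLp (fun ω => ∑ i ∈ s, a i • f i ω) 2 κ :=
  memLp_finsetSum s fun i _ => (hf i).const_smul (a i)

lemma inner_toLp {U V : Ω → ℝ} (hU : MemLp U 2 P) (hV : MemLp V 2 P) :
    inner ℝ hU.toLp hV.toLp = ∫ ω, U ω * V ω ∂P := by
  rw [L2.inner_def]
  refine integral_congr_ae ?_
  filter_upwards [hU.coeFn_toLp, hV.coeFn_toLp] with ω h1 h2
  rw [h1, h2]; simp [mul_comm]

lemma lintegral_sq_sub_eq {U V : Ω → ℝ} (hU : MemLp U 2 P) (hV : MemLp V 2 P) :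
    ∫⁻ ω, ENNReal.ofReal ((U ω - V ω) ^ 2) ∂P =
      ENNReal.ofReal (‖hU.toLp - hV.toLp‖ ^ 2) := by
  rw [← MemLp.toLp_sub, ← real_inner_self_eq_norm_sq, inner_toLp,
    ofReal_integral_eq_lintegral_ofReal]
  · simp [sq]
  · exact (hU.sub hV).integrable_mul (hU.sub hV)
  · exact ae_of_all _ fun ω => mul_self_nonneg _

lemma tendsto_eLpNorm_sub_sum_iff {V : ℤ → Ω → ℝ} (hV : ∀ n, MemLp (V n) 2 P) {U : Ω → ℝ}
    (hU : MemLp U 2 P) (a : ℤ → ℝ) :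
    Tendsto (fun N : ℕ => eLpNorm
      (fun ω => U ω - ∑ n ∈ Finset.Icc (-(N : ℤ)) (N : ℤ), a n * V n ω) 2 P) atTop (𝓝 0) ↔
    Tendsto (fun N : ℕ => ∑ n ∈ Finset.Icc (-(N : ℤ)) (N : ℤ), a n • (hV n).toLp) atTop
      (𝓝 hU.toLp) := by
  rw [tendsto_iff_edist_tendsto_0]
  refine tendsto_congr fun N => ?_
  rw [← toLp_sum hV _ a (memLp_sum_smul hV _ a), edist_comm, Lp.edist_toLp_toLp]
  rfl

lemma timeAverageMSE_const {X Xhat : ℝ → Ω → ℝ} {D : ℝ≥0∞}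
    (h : ∀ t, ∫⁻ ω, ENNReal.ofReal ((X t ω - Xhat t ω) ^ 2) ∂P = D) {T : ℝ} (hT : 0 < T) :
    timeAverageMSE P X Xhat T = D := by
  rw [timeAverageMSE]
  simp_rw [h]
  rw [setLIntegral_const, Real.volume_Icc, show T - -T = 2 * T by ring, mul_comm, mul_assoc,
    ENNReal.mul_inv_cancel (by simpa using hT) ENNReal.ofReal_ne_top, mul_one]

lemma le_timeAverageMSE {X Xhat : ℝ → Ω → ℝ} {D : ℝ≥0∞}
    (h : ∀ t, D ≤ ∫⁻ ω, ENNReal.ofReal ((X t ω - Xhat t ω) ^ 2) ∂P) {T : ℝ} (hT : 0 < T) :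
    D ≤ timeAverageMSE P X Xhat T := by
  have h1 : ∫⁻ _ in Icc (-T) T, D ≤
      ∫⁻ t in Icc (-T) T, ∫⁻ ω, ENNReal.ofReal ((X t ω - Xhat t ω) ^ 2) ∂P :=
    lintegral_mono h
  rw [setLIntegral_const, Real.volume_Icc, show T - -T = 2 * T by ring] at h1
  calc D = (ENNReal.ofReal (2 * T))⁻¹ * (D * ENNReal.ofReal (2 * T)) := by
        rw [mul_comm, mul_assoc,
          ENNReal.mul_inv_cancel (by simpa using hT) ENNReal.ofReal_ne_top, mul_one]
    _ ≤ _ := by rw [timeAverageMSE]; gcongr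

/-- Wiener's principle: suppose that the observations `V n` have the Gram matrix of vectors `w n` of
a Hilbert space in which `G t` represents `X t`, that the residual `‖X t‖² - ‖G t‖²` is a
constant `D`, and that `G t` is the sum of a series in the `w n` with square summable coefficients.
Then `D` is the least distortion. -/
lemma isLeast_linearDistortions {F : Type*} [NormedAddCommGroup F] [InnerProductSpace ℝ F]
    {X : ℝ → Ω → ℝ} {V : ℤ → Ω → ℝ} (hX : ∀ t, MemLp (X t) 2 P) (hV : ∀ n, MemLp (V n) 2 P)
    {w : ℤ → F} {G : ℝ → F} {D : ℝ} {c : ℝ → ℤ → ℝ}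
    (hVV : ∀ m n, inner ℝ (hV m).toLp (hV n).toLp = inner ℝ (w m) (w n))
    (hXV : ∀ t n, inner ℝ (hX t).toLp (hV n).toLp = inner ℝ (G t) (w n))
    (hD : ∀ t, ‖(hX t).toLp‖ ^ 2 - ‖G t‖ ^ 2 = D)
    (hc : ∀ t, Summable fun n => c t n ^ 2)
    (hG : ∀ t, Tendsto (fun N : ℕ => ∑ n ∈ Finset.Icc (-(N : ℤ)) (N : ℤ), c t n • w n) atTop
      (𝓝 (G t))) :
    IsLeast (linearDistortions P X V) D := by
  constructor
  · choose u hu hmem using fun t => exists_tendsto_of_tendsto_of_gram hVV (hG t)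
    have hu2 : ∀ t, MemLp (u t) 2 P := fun t => Lp.memLp (u t)
    have herr : ∀ t, ‖(hX t).toLp - u t‖ ^ 2 = D := by
      intro t
      rw [norm_sub_sq_of_mem_jointSpan hVV (hXV t) (hmem t), sub_self, hD]
      simp
    refine ⟨by rw [← herr 0]; positivity, fun t => u t, ⟨c, fun t => ⟨hc t, hu2 t, ?_⟩⟩, ?_⟩
    · rw [tendsto_eLpNorm_sub_sum_iff hV (hu2 t), Lp.toLp_coeFn]
      exact hu t
    · refine tendsto_const_nhds.congr' ?_
      filter_upwards [eventually_gt_atTop 0] with T hT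
      refine (timeAverageMSE_const (fun t => ?_) hT).symm
      rw [lintegral_sq_sub_eq (hX t) (hu2 t), Lp.toLp_coeFn, herr]
  · rintro D' ⟨hD'0, Xhat, ⟨a, ha⟩, hlim⟩
    have herr : ∀ t, D ≤ ‖(hX t).toLp - (ha t).2.1.toLp‖ ^ 2 := by
      intro t
      have h1 := (tendsto_eLpNorm_sub_sum_iff hV (ha t).2.1 (a t)).mp (ha t).2.2
      refine ge_of_tendsto' ((h1.const_sub (hX t).toLp).norm.pow 2) fun N => ?_
      have := norm_sub_sq_of_mem_jointSpan hVV (hXV t)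
        (sum_mem_jointSpan _ w (Finset.Icc (-(N : ℤ)) (N : ℤ)) (a t))
      rw [this, hD]
      have := sq_nonneg ‖G t - ∑ n ∈ Finset.Icc (-(N : ℤ)) (N : ℤ), a t n • w n‖
      linarith
    have hle : ENNReal.ofReal D ≤ ENNReal.ofReal D' := by
      refine ge_of_tendsto hlim ?_
      filter_upwards [eventually_gt_atTop 0] with T hT
      refine le_timeAverageMSE (fun t => ?_) hT
      rw [lintegral_sq_sub_eq (hX t) (ha t).2.1]
      exact ENNReal.ofReal_le_ofReal (herr t)
    exact (ENNReal.ofReal_le_ofReal_iff hD'0).mp hle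

end Reconstruction

/-! ### Spectral concentration of a unimodal density -/

/-- Among the sets of measure at most `fs`, the centred interval captures the most power of a
unimodal density. -/
lemma mmseLowerBound_eq {S : ℝ → ℝ} (hS : IsUnimodal S) (h0 : ∀ f, 0 ≤ S f) (hi : Integrable S)
    {fs : ℝ} (hfs : 0 < fs) :
    mmseLowerBound S fs = (∫ f, S f) - ∫ f in Ioc (-(fs / 2)) (fs / 2), S f := by
  rw [mmseLowerBound]
  congr 1
  refine IsGreatest.csSup_eq ⟨⟨_, measurableSet_Ioc, ?_, rfl⟩, ?_⟩
  · rw [Real.volume_Ioc]; ring_nf; rfl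
  rintro _ ⟨F, hF, hvol, rfl⟩
  set B := Ioc (-(fs / 2)) (fs / 2) with hB
  set s := S (fs / 2) with hs
  have hBv : volume B = ENNReal.ofReal fs := by
    rw [hB, Real.volume_Ioc]; ring_nf
  have habs : ∀ f, S f = S |f| := by
    intro f
    rcases abs_choice f with e | e <;> rw [e]
    exact (hS.1 f).symm
  have hin : ∀ f ∈ B, f ≠ 0 → s ≤ S f := by
    intro f hf hne
    rw [habs f]
    exact hS.2 (abs_pos.mpr hne) (by simpa using hfs) (abs_le.mpr ⟨hf.1.le, hf.2⟩)
  have hout : ∀ f, f ∉ B → S f ≤ s := by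
    intro f hf
    rw [habs f]
    have hle : fs / 2 ≤ |f| := by
      by_contra hlt
      rw [not_le, abs_lt] at hlt
      exact hf ⟨hlt.1, hlt.2.le⟩
    exact hS.2 (by simpa using hfs) (lt_of_lt_of_le (by simpa using hfs) hle) hle
  have hFfin : volume F ≠ ∞ := ne_top_of_le_ne_top ENNReal.ofReal_ne_top hvol
  have hBfin : volume B ≠ ∞ := by rw [hBv]; exact ENNReal.ofReal_ne_top
  have hBm : MeasurableSet B := measurableSet_Ioc
  have e1 := integral_inter_add_sdiff (μ := volume) (s := F) (t := B) hBm (hi.integrableOn (s := F))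
  have e2 := integral_inter_add_sdiff (μ := volume) (s := B) (t := F) hF (hi.integrableOn (s := B))
  have v1 := measureReal_inter_add_sdiff (μ := volume) (s := F) hBm hFfin
  have v2 := measureReal_inter_add_sdiff (μ := volume) (s := B) hF hBfin
  rw [inter_comm] at e2 v2
  have hv : volume.real F ≤ volume.real B :=
    ENNReal.toReal_mono hBfin (hvol.trans hBv.ge)
  have i1 : ∫ f in F \ B, S f ≤ s * volume.real (F \ B) := by
    have : ∫ f in F \ B, S f ≤ ∫ _ in F \ B, s :=
      setIntegral_mono_on hi.integrableOn
        (integrableOn_const (ne_top_of_le_ne_top hFfin (measure_mono sdiff_subset)))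
        (hF.diff hBm) fun f hf => hout f hf.2
    rwa [setIntegral_const, smul_eq_mul, mul_comm] at this
  have i2 : s * volume.real (B \ F) ≤ ∫ f in B \ F, S f := by
    have : ∫ _ in B \ F, s ≤ ∫ f in B \ F, S f := by
      refine setIntegral_mono_on_ae
        (integrableOn_const (ne_top_of_le_ne_top hBfin (measure_mono sdiff_subset)))
        hi.integrableOn (hBm.diff hF) ?_
      -- unimodality says nothing about the value at the origin
      filter_upwards [Measure.ae_ne volume (0 : ℝ)] with f hf hfm
      exact hin f hfm.1 hf
    rwa [setIntegral_const, smul_eq_mul, mul_comm] at this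
  have hs0 : 0 ≤ s := h0 _
  nlinarith

/-! ### Spectral representations -/

section Spectral

variable {Ω : Type*} [MeasurableSpace Ω] {P : Measure Ω}

lemma inner_toLp_withDensity {κ : Measure ℝ} {D : ℝ → ℝ} (hD : AEMeasurable D κ)
    (hD0 : ∀ f, 0 ≤ D f) {φ ψ : ℝ → ℂ}
    (hφ : MemLp φ 2 (κ.withDensity fun f => ENNReal.ofReal (D f)))
    (hψ : MemLp ψ 2 (κ.withDensity fun f => ENNReal.ofReal (D f))) :
    inner ℝ hφ.toLp hψ.toLp = ∫ f, D f * ((starRingEnd ℂ) (φ f) * ψ f).re ∂κ := by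
  rw [L2.inner_def]
  have : ∫ f, inner ℝ (hφ.toLp φ f) (hψ.toLp ψ f) ∂(κ.withDensity fun f => ENNReal.ofReal (D f)) =
      ∫ f, ((starRingEnd ℂ) (φ f) * ψ f).re ∂(κ.withDensity fun f => ENNReal.ofReal (D f)) := by
    refine integral_congr_ae ?_
    filter_upwards [hφ.coeFn_toLp, hψ.coeFn_toLp] with f h1 h2
    rw [h1, h2, Complex.inner, mul_comm]
  rw [this, integral_withDensity_eq_integral_toReal_smul₀ hD.ennreal_ofReal
    (ae_of_all _ fun f => ENNReal.ofReal_lt_top)]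
  refine integral_congr_ae (ae_of_all _ fun f => ?_)
  simp only [ENNReal.toReal_ofReal (hD0 f), smul_eq_mul]

lemma memLp_of_norm_le_one {κ : Measure ℝ} [IsFiniteMeasure κ] {φ : ℝ → ℂ}
    (hm : AEStronglyMeasurable φ κ) (h : ∀ x, ‖φ x‖ ≤ 1) : MemLp φ 2 κ :=
  MemLp.of_bound hm 1 (ae_of_all _ h)

lemma memLp_wave {κ : Measure ℝ} [IsFiniteMeasure κ] (u : ℝ) : MemLp (wave u) 2 κ :=
  memLp_of_norm_le_one (continuous_wave u).aestronglyMeasurable fun x => (norm_wave u x).le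

lemma measurable_idealLowPass (fs : ℝ) : Measurable (idealLowPass fs) := by
  unfold idealLowPass
  exact Measurable.ite (measurableSet_le (by fun_prop) (by fun_prop)) measurable_const
    measurable_const

lemma memLp_lowPass_mul_wave {κ : Measure ℝ} [IsFiniteMeasure κ] (fs u : ℝ) :
    MemLp (fun f => idealLowPass fs f * wave u f) 2 κ := by
  refine memLp_of_norm_le_one
    ((measurable_idealLowPass fs).mul (continuous_wave u).measurable).aestronglyMeasurable
    fun x => ?_
  rw [norm_mul, norm_wave, mul_one, idealLowPass]
  split_ifs <;> simp

lemma conj_wave_mul_wave (s t f : ℝ) :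
    (starRingEnd ℂ) (wave s f) * wave t f = wave (t - s) f := by
  rw [conj_wave, ← wave_add]; ring_nf

/-- Integrating against the ideal low-pass filter restricts to the band. -/
lemma integral_mul_lowPass_re {fs : ℝ} (S : ℝ → ℝ) (φ : ℝ → ℂ) :
    ∫ f, S f * (idealLowPass fs f * φ f).re =
      ∫ f in Ioc (-(fs / 2)) (fs / 2), S f * (φ f).re := by
  rw [← integral_Icc_eq_integral_Ioc, ← integral_indicator measurableSet_Icc]
  congr 1; ext f
  by_cases h : |f| ≤ fs / 2
  · rw [indicator_of_mem (show f ∈ Icc _ _ from abs_le.mp h), idealLowPass, if_pos h, one_mul]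
  · rw [indicator_of_notMem (show f ∉ Icc _ _ from fun h' => h (abs_le.mpr h')), idealLowPass,
      if_neg h]
    simp

lemma conj_idealLowPass (fs f : ℝ) :
    (starRingEnd ℂ) (idealLowPass fs f) = idealLowPass fs f := by
  rw [idealLowPass]; split_ifs <;> simp

lemma idealLowPass_mul_self (fs f : ℝ) :
    idealLowPass fs f * idealLowPass fs f = idealLowPass fs f := by
  rw [idealLowPass]; split_ifs <;> simp

lemma IsStationaryWithPSD.inner_eq {X : ℝ → Ω → ℝ} {S : ℝ → ℝ} (hX : IsStationaryWithPSD P X S)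
    (s t : ℝ) : inner ℝ (hX.memLp s).toLp (hX.memLp t).toLp =
      ∫ f, S f * (wave (t - s) f).re := by
  have h := hX.autocorrelation s (t - s)
  rw [add_sub_cancel] at h
  have h2 := congrArg Complex.re h
  rw [Complex.ofReal_re] at h2
  rw [real_inner_comm, inner_toLp, h2]
  have hi : Integrable fun f : ℝ => (S f : ℂ) * wave (t - s) f :=
    hX.psd_integrable.ofReal.mul_bdd (c := 1) (continuous_wave _).aestronglyMeasurable
      (ae_of_all _ fun x => (norm_wave _ x).le)
  have := integral_re hi
  simp only [RCLike.re_eq_complex_re] at this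
  simp only [← Complex.re_ofReal_mul]
  rw [this]
  rfl

/-- The isometry between the process and the exponentials in `L²(S(f) df)`. -/
lemma IsStationaryWithPSD.inner_eq_inner_wave {X : ℝ → Ω → ℝ} {S : ℝ → ℝ}
    (hX : IsStationaryWithPSD P X S)
    [IsFiniteMeasure (volume.withDensity fun f => ENNReal.ofReal (S f))] (s t : ℝ) :
    inner ℝ (hX.memLp s).toLp (hX.memLp t).toLp =
      inner ℝ (memLp_wave (κ := volume.withDensity fun f => ENNReal.ofReal (S f)) s).toLp
        (memLp_wave t).toLp := by
  rw [hX.inner_eq, inner_toLp_withDensity hX.psd_integrable.aestronglyMeasurable.aemeasurable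
    hX.psd_nonneg]
  simp_rw [conj_wave_mul_wave]

/-- The output of a filter is the image of its transfer function under the isometry. -/
lemma IsFilterOutput.mem_jointSpan {X Z : ℝ → Ω → ℝ} {S : ℝ → ℝ} {H : ℝ → ℂ}
    (hZ : IsFilterOutput P X S H Z) (hX : ∀ t, MemLp (X t) 2 P)
    (he : ∀ u, MemLp (wave u) 2 (volume.withDensity fun f => ENNReal.ofReal (S f))) (t : ℝ)
    (hH : MemLp (fun f => H f * wave t f) 2 (volume.withDensity fun f => ENNReal.ofReal (S f))) :
    ((hZ t).1.toLp, hH.toLp) ∈ jointSpan (fun u => (hX u).toLp) (fun u => (he u).toLp) := by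
  have hcl : IsClosed (jointSpan (fun u => (hX u).toLp) (fun u => (he u).toLp)).carrier :=
    Submodule.isClosed_topologicalClosure _
  refine hcl.closure_subset (Metric.mem_closure_iff.mpr fun ε hε => ?_)
  obtain ⟨a, h1, h2⟩ := (hZ t).2 (ENNReal.ofReal ε) (by simpa using hε)
  refine ⟨_, sum_mem_jointSpan _ _ a.support a, ?_⟩
  rw [← toLp_sum hX _ a (memLp_sum_smul hX _ a), ← toLp_sum he _ a (memLp_sum_smul he _ a),
    Prod.dist_eq, max_lt_iff, ← edist_lt_ofReal, ← edist_lt_ofReal, Lp.edist_toLp_toLp,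
    Lp.edist_toLp_toLp]
  refine ⟨h2, ?_⟩
  simpa only [Finsupp.sum, wave, Pi.sub_def, Complex.real_smul] using h1

/-- Gram matrix of the low-pass filtered process. -/
lemma IsFilterOutput.inner_lowPass {X Z : ℝ → Ω → ℝ} {S : ℝ → ℝ} {fs : ℝ}
    (hX : IsStationaryWithPSD P X S) (hZ : IsFilterOutput P X S (idealLowPass fs) Z) (s t : ℝ) :
    inner ℝ (hZ s).1.toLp (hZ t).1.toLp =
      ∫ f in Ioc (-(fs / 2)) (fs / 2), S f * (wave (t - s) f).re := by
  have hfin := isFiniteMeasure_withDensity_ofReal hX.psd_integrable.2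
  have hSm := hX.psd_integrable.aestronglyMeasurable.aemeasurable
  have := inner_fst_eq_inner_snd hX.inner_eq_inner_wave
    (hZ.mem_jointSpan hX.memLp (fun u => memLp_wave u) s (memLp_lowPass_mul_wave fs s))
    (hZ.mem_jointSpan hX.memLp (fun u => memLp_wave u) t (memLp_lowPass_mul_wave fs t))
  rw [this, inner_toLp_withDensity hSm hX.psd_nonneg, ← integral_mul_lowPass_re]
  congr 1; ext f
  rw [map_mul, conj_idealLowPass, mul_mul_mul_comm, idealLowPass_mul_self, conj_wave_mul_wave]

/-- Cross-correlation of the process with its low-pass filtered version. -/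
lemma IsFilterOutput.inner_input_lowPass {X Z : ℝ → Ω → ℝ} {S : ℝ → ℝ} {fs : ℝ}
    (hX : IsStationaryWithPSD P X S) (hZ : IsFilterOutput P X S (idealLowPass fs) Z) (s t : ℝ) :
    inner ℝ (hX.memLp s).toLp (hZ t).1.toLp =
      ∫ f in Ioc (-(fs / 2)) (fs / 2), S f * (wave (t - s) f).re := by
  have hfin := isFiniteMeasure_withDensity_ofReal hX.psd_integrable.2
  have hSm := hX.psd_integrable.aestronglyMeasurable.aemeasurable
  have := inner_eq_inner_of_mem_jointSpan (hX.inner_eq_inner_wave s)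
    (hZ.mem_jointSpan hX.memLp (fun u => memLp_wave u) t (memLp_lowPass_mul_wave fs t))
  rw [this, inner_toLp_withDensity hSm hX.psd_nonneg, ← integral_mul_lowPass_re]
  congr 1; ext f
  rw [mul_left_comm, conj_wave_mul_wave]

/-- Noise orthogonal to the input of a filter is orthogonal to its output. -/
lemma IsFilterOutput.inner_eq_zero {X Z : ℝ → Ω → ℝ} {S : ℝ → ℝ} {fs : ℝ}
    (hX : IsStationaryWithPSD P X S) (hZ : IsFilterOutput P X S (idealLowPass fs) Z)
    {a : Lp ℝ 2 P} (ha : ∀ t, inner ℝ a (hX.memLp t).toLp = 0) (t : ℝ) :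
    inner ℝ a (hZ t).1.toLp = 0 := by
  have hfin := isFiniteMeasure_withDensity_ofReal hX.psd_integrable.2
  have := inner_eq_inner_of_mem_jointSpan
    (y := fun u => (memLp_wave (κ := volume.withDensity fun f => ENNReal.ofReal (S f)) u).toLp)
    (b := 0) (fun u => by rw [ha, inner_zero_left])
    (hZ.mem_jointSpan hX.memLp (fun u => memLp_wave u) t (memLp_lowPass_mul_wave fs t))
  rw [this, inner_zero_left]

lemma IsWhiteNoise.inner_eq [IsProbabilityMeasure P] {η : ℤ → Ω → ℝ} {v : ℝ}
    (hη : IsWhiteNoise P η v) (m n : ℤ) :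
    inner ℝ (hη.memLp m).toLp (hη.memLp n).toLp = if m = n then v else 0 := by
  have h : inner ℝ (hη.memLp m).toLp (hη.memLp n).toLp = covariance (η m) (η n) P := by
    rw [inner_toLp, covariance_eq_sub (hη.memLp m) (hη.memLp n), hη.mean_zero]
    simp
  rw [h]
  split_ifs with e
  · subst e
    rw [covariance_self (hη.memLp m).aemeasurable, hη.variance_eq]
  · exact hη.uncorrelated m n e

/-- The gain `S / (S + c)` of the Wiener filter for a unimodal signal spectrum `S` in white noise of
spectral density `c`. -/
lemma IsUnimodal.isUnimodalGain {S : ℝ → ℝ} (hS : IsUnimodal S) (h0 : ∀ f, 0 ≤ S f)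
    (hm : AEStronglyMeasurable S) {c : ℝ} (hc : 0 < c) :
    IsUnimodalGain fun f => S f / (S f + c) where
  even f := by simp only [hS.1]
  antitoneOn x hx y hy hxy := by
    have := hS.2 hx hy hxy
    have h1 := h0 x
    have h2 := h0 y
    simp only
    rw [div_le_div_iff₀ (by positivity) (by positivity)]
    nlinarith
  nonneg f := by have := h0 f; positivity
  le_one f := by
    have := h0 f
    rw [div_le_one (by positivity)]; linarith
  aestronglyMeasurable := by
    have := hm.aemeasurable
    exact (this.div (this.add_const c)).aestronglyMeasurable

end Spectral

/-! ### The distortion of quantized samples -/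

theorem mainTheorem8 {Ω : Type*} [MeasurableSpace Ω] (P : Measure Ω) [IsProbabilityMeasure P]
    (X : ℝ → Ω → ℝ) (S : ℝ → ℝ) (hX : IsStationaryWithPSD P X S) (hS : IsUnimodal S)
    (fs R q c₀ : ℝ) (hfs : 0 < fs) (hq : 0 < q) (hc₀ : 0 < c₀) (hR : R = q * fs)
    (Z : ℝ → Ω → ℝ) (hZ : IsFilterOutput P X S (idealLowPass fs) Z)
    (η : ℤ → Ω → ℝ) (hη : IsWhiteNoise P η (c₀ / ((2 : ℝ) ^ q - 1) ^ 2))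
    (hηX : ∀ (n : ℤ) (t : ℝ), covariance (η n) (X t) P = 0) :
    linearMMSE P X (quantizedSamples Z fs η) ∈
        linearDistortions P X (quantizedSamples Z fs η) ∧
      linearMMSE P X (quantizedSamples Z fs η) =
        mmseLowerBound S fs +
          ∫ f in (-(fs / 2))..(fs / 2), S f / (1 + pcmSNR S c₀ fs R f) := by
  set B := Ioc (-(fs / 2)) (fs / 2) with hB
  have hA : 0 < (2 : ℝ) ^ q - 1 := by
    have := Real.one_lt_rpow (x := 2) (by norm_num) hq
    linarith
  set v : ℝ := c₀ / ((2 : ℝ) ^ q - 1) ^ 2 with hv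
  have hv0 : 0 < v := by positivity
  -- the power spectral density of the noise, seen as a function of the analog frequency
  set c : ℝ := v / fs with hc
  have hc0 : 0 < c := by positivity
  have hS0 := hX.psd_nonneg
  have hSi := hX.psd_integrable
  have hSm := hSi.aestronglyMeasurable
  set g : ℝ → ℝ := fun f => S f / (S f + c) with hg
  have hgain : IsUnimodalGain g := hS.isUnimodalGain hS0 hSm hc0
  have hSg : ∀ f, (S f + c) * g f = S f := fun f => by
    have := hS0 f
    simp only [hg]; field_simp
  have hDi : IntegrableOn (fun f => S f + c) B :=
    hSi.integrableOn.add (integrableOn_const (by simp [hB]))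
  have hD0 : ∀ f, 0 ≤ S f + c := fun f => by have := hS0 f; positivity
  have hDm := hDi.aestronglyMeasurable.aemeasurable
  set μ : Measure ℝ := (volume.restrict B).withDensity fun f => ENNReal.ofReal (S f + c) with hμ
  have hfin : IsFiniteMeasure μ := isFiniteMeasure_withDensity_ofReal hDi.2
  have hac : μ ≪ volume.restrict B := withDensity_absolutelyContinuous _ _
  have hGm : ∀ t, MemLp (fun f => (g f : ℂ) * wave t f) 2 μ := fun t =>
    memLp_of_norm_le_one ((hgain.aestronglyMeasurable_mul_wave t).restrict.mono_ac hac)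
      (hgain.norm_mul_wave_le t)
  have hV : ∀ n, MemLp (quantizedSamples Z fs η n) 2 P := fun n =>
    (hZ (n / fs)).1.add (hη.memLp n)
  have hVadd : ∀ n, (hV n).toLp = (hZ (n / fs)).1.toLp + (hη.memLp n).toLp := fun n => rfl
  have hηX' : ∀ n t, inner ℝ (hη.memLp n).toLp (hX.memLp t).toLp = 0 := by
    intro n t
    have := hηX n t
    rw [covariance_eq_sub (hη.memLp n) (hX.memLp t), hη.mean_zero, zero_mul, sub_zero] at this
    rw [inner_toLp]; exact this
  have hηZ : ∀ n t, inner ℝ (hη.memLp n).toLp (hZ t).1.toLp = 0 := fun n t =>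
    hZ.inner_eq_zero hX (hηX' n) t
  have hwi : ∀ u, IntegrableOn (wave u) B := fun u => (continuous_wave u).integrableOn_Ioc
  have hwre : ∀ u, IntegrableOn (fun f => (wave u f).re) B := fun u => (hwi u).re
  have hSwre : ∀ u, IntegrableOn (fun f => S f * (wave u f).re) B := fun u =>
    (hSi.integrableOn (s := B)).mul_bdd (c := 1)
      (Complex.continuous_re.comp (continuous_wave u)).aestronglyMeasurable
      (ae_of_all _ fun x => (Complex.abs_re_le_norm _).trans (norm_wave u x).le)
  have hleast : IsLeast (linearDistortions P X (quantizedSamples Z fs η))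
      ((∫ f, S f) - ∫ f in B, S f * g f) := by
    refine isLeast_linearDistortions hX.memLp hV
      (w := fun n : ℤ => (memLp_wave (κ := μ) (n / fs)).toLp)
      (G := fun t => (hGm t).toLp)
      (c := fun t n => (fourierCoeffBand fs (fun f => (g f : ℂ) * wave t f) n).re)
      ?_ ?_ ?_ ?_ ?_
    · intro m n
      rw [hVadd, hVadd, inner_add_left, inner_add_right, inner_add_right, hηZ,
        real_inner_comm (hη.memLp n).toLp, hηZ, hη.inner_eq, hZ.inner_lowPass hX,
        inner_toLp_withDensity hDm hD0]
      simp_rw [conj_wave_mul_wave, add_mul]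
      rw [integral_add (hSwre _) ((hwre _).const_mul c), integral_const_mul]
      have e : ((n : ℝ) / fs - m / fs) = ((n - m : ℤ) : ℝ) / fs := by push_cast; ring
      have h1 : ∫ f in B, (wave ((n : ℝ) / fs - m / fs) f).re = if m = n then fs else 0 := by
        have := integral_re (hwi ((n : ℝ) / fs - m / fs))
        simp only [RCLike.re_eq_complex_re] at this
        rw [this, e, integral_wave_band hfs]
        by_cases hmn : m = n
        · simp [hmn]
        · rw [if_neg (by omega), if_neg hmn, Complex.zero_re]
      rw [h1]
      split_ifs
      · rw [hc]; field_simp; ring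
      · ring
    · intro t n
      rw [hVadd, inner_add_right, real_inner_comm (hη.memLp n).toLp, hηX',
        hZ.inner_input_lowPass hX, inner_toLp_withDensity hDm hD0, add_zero]
      congr 1; ext f
      rw [map_mul, Complex.conj_ofReal, mul_assoc, conj_wave_mul_wave, Complex.re_ofReal_mul,
        ← mul_assoc, hSg]
    · intro t
      rw [← real_inner_self_eq_norm_sq, ← real_inner_self_eq_norm_sq, hX.inner_eq,
        inner_toLp_withDensity hDm hD0]
      congr 1
      · simp
      · congr 1; ext f
        rw [map_mul, Complex.conj_ofReal, mul_mul_mul_comm, conj_wave_mul_wave, sub_self,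
          wave_zero, mul_one, ← Complex.ofReal_mul, Complex.ofReal_re, ← mul_assoc, hSg]
    · intro t
      have hb : MemLp (fun f => (g f : ℂ) * wave t f) 2 (volume.restrict B) :=
        memLp_of_norm_le_one (hgain.aestronglyMeasurable_mul_wave t).restrict
          (hgain.norm_mul_wave_le t)
      refine (summable_sq_fourierCoeffBand hfs hb).of_nonneg_of_le (fun n => sq_nonneg _)
        fun n => ?_
      rw [← sq_abs]
      gcongr
      exact Complex.abs_re_le_norm _
    · intro t
      have hb : MemLp (fun f => (g f : ℂ) * wave t f) 2 (volume.restrict B) :=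
        memLp_of_norm_le_one (hgain.aestronglyMeasurable_mul_wave t).restrict
          (hgain.norm_mul_wave_le t)
      have ht := tendsto_eLpNorm_of_bounded_of_absolutelyContinuous hac
        (h := fun N => fourierPartialSum fs (fun f => (g f : ℂ) * wave t f) N -
          fun f => (g f : ℂ) * wave t f) (K := 1 + 2 * (2 + 2 * |t * fs|) + 1)
        (fun N => (continuous_fourierPartialSum _ _ N).aestronglyMeasurable.sub hb.1)
        (fun N x => (norm_sub_le _ _).trans (add_le_add (hgain.norm_fourierPartialSum_le hfs t N x)
          (hgain.norm_mul_wave_le t x)))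
        (tendsto_eLpNorm_sub_fourierPartialSum hfs hb)
      rw [tendsto_iff_edist_tendsto_0]
      refine ht.congr fun N => ?_
      rw [← toLp_sum (fun n : ℤ => memLp_wave (κ := μ) (n / fs)) _ _
        (memLp_sum_smul (fun n : ℤ => memLp_wave (κ := μ) (n / fs)) _ _), Lp.edist_toLp_toLp]
      congr 1; ext f
      simp only [Pi.sub_apply, fourierPartialSum, Complex.real_smul,
        hgain.fourierCoeffBand_re hfs]
  have hval : mmseLowerBound S fs + ∫ f in (-(fs / 2))..(fs / 2), S f / (1 + pcmSNR S c₀ fs R f) =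
      (∫ f, S f) - ∫ f in B, S f * g f := by
    rw [mmseLowerBound_eq hS hS0 hSi hfs, intervalIntegral.integral_of_le (by linarith)]
    have hSgi : IntegrableOn (fun f => S f * g f) B :=
      (hSi.integrableOn (s := B)).mul_bdd (c := 1) hgain.aestronglyMeasurable.restrict
        (ae_of_all _ fun x => by
          rw [Real.norm_of_nonneg (hgain.nonneg x)]; exact hgain.le_one x)
    have : ∀ f, S f / (1 + pcmSNR S c₀ fs R f) = S f - S f * g f := by
      intro f
      have h0 := hS0 f
      have hRq : R / fs = q := by rw [hR]; field_simp
      have hsnr : pcmSNR S c₀ fs R f = S f / c := by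
        rw [pcmSNR, hRq, hc, hv]; field_simp
      rw [hsnr]
      simp only [hg]; field_simp; ring
    simp_rw [this]
    rw [integral_sub hSi.integrableOn hSgi]
    ring
  rw [linearMMSE, hleast.csInf_eq, hval]
  exact ⟨hleast.1, rfl⟩
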